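/- Let $G$ be a simple graph with a vertex $x$ of degree $10$, and let $G_x = G[N(x)]$ be the subgraph of $G$ induced by the neighbours of $x$. Suppose that the complement $\overline{G_x}$ of $G_x$ is connected and cubic (i.e. $3$-regular). Moreover, suppose that there is a vertex $z \in V(G) \setminus N[x]$, where $N[x] = N(x) \cup \{x\}$, such that $G$ contains at least six internally vertex-disjoint $(x,z)$-paths. Then $G$ contains a $K_8^-$ minor, where $K_8^-$ denotes the complete graph on $8$ vertices with one edge removed; that is, there are eight non-empty pairwise disjoint sets of vertices of $G$, each inducing a connected subgraph of $G$, such that, with the exception of at most one pair, any two of these sets are joined by at least one edge of $G$. -/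

import Mathlib

/-- `H` is a minor of `G`: there are non-empty, pairwise disjoint branch sets `B h` of vertices of
`G`, one for each vertex `h` of `H`, each inducing a connected subgraph of `G`, such that for any
two adjacent vertices of `H` some edge of `G` joins the corresponding branch sets. -/
def SimpleGraph.HasMinor {V W : Type*} (G : SimpleGraph V) (H : SimpleGraph W) : Prop :=
  ∃ B : W → Set V,
    (∀ h, (B h).Nonempty) ∧
    (∀ h₁ h₂, h₁ ≠ h₂ → Disjoint (B h₁) (B h₂)) ∧
    (∀ h, (G.induce (B h)).Connected) ∧
    (∀ h₁ h₂, H.Adj h₁ h₂ → ∃ u ∈ B h₁, ∃ v ∈ B h₂, G.Adj u v)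

/-- The complete graph on `8` vertices with one edge removed. -/
def completeEightMinusEdge : SimpleGraph (Fin 8) :=
  (⊤ : SimpleGraph (Fin 8)).deleteEdges {s(0, 1)}

/-- The neighbourhood graph of `x` in `G`: the subgraph induced by the neighbours of `x`. -/
abbrev SimpleGraph.neighborhoodGraph {V : Type*} (G : SimpleGraph V) (x : V) :
    SimpleGraph (G.neighborSet x) :=
  G.induce (G.neighborSet x)

/-- `G` contains `k` distinct `(x, z)`-paths, any two of which have at most the vertices
`x` and `z` in common. -/
def SimpleGraph.HasInternallyDisjointPaths {V : Type*} (G : SimpleGraph V) (x z : V) (k : ℕ) :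
    Prop :=
  ∃ P : Fin k → G.Path x z,
    Function.Injective P ∧
    ∀ i j, i ≠ j → ∀ v, v ∈ (P i).1.support → v ∈ (P j).1.support → v = x ∨ v = z

/-! Since `x` is adjacent to all of `N(x)`, it can serve as a branch set by itself, and seven branch
sets forming a `K₇⁻` model in the neighbourhood suffice. If the neighbourhood alone does not provide
them, the six paths help: their parts after the last neighbour of `x` all contain `z`, so they unite
to a connected set `K` outside `N[x]` that is adjacent to six distinct neighbours of `x`
(`exists_connected`). One branch set may then absorb `K`.

What remains is finite. A connected cubic graph of order ten has a breadth-first labelling, and a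
search over all such labellings covers every possible complement (`exists_labelling`); isomorphic
repetitions do no harm. At each leaf the kernel checks that a listed model works, either inside
`N[x]` or, for each possible set of six labels adjacent to `K`, with the help of `K`
(`search_hasListedModel`). `hasMinor_of_isModel` turns label models into minors of `G`. -/

/-- `List.any`, by a bare recursor, which the kernel evaluates faster. -/
def anyOf {α : Type*} (l : List α) (p : α → Bool) : Bool :=
  List.rec false (fun a _ b => bif p a then true else b) l

/-- `List.all`, by a bare recursor, which the kernel evaluates faster. -/
def allOf {α : Type*} (l : List α) (p : α → Bool) : Bool :=
  List.rec true (fun a _ b => bif p a then b else false) l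

/-- The entry `(i, j)` of the adjacency matrix of order ten encoded by `E`. -/
def entry (E i j : ℕ) : Bool :=
  Nat.beq (Nat.land (Nat.shiftRight E (Nat.add (Nat.mul 10 i) j)) 1) 1

/-- Set the entries `(i, j)` and `(j, i)`. -/
def setEntry (E i j : ℕ) : ℕ :=
  Nat.lor E (Nat.lor (Nat.shiftLeft 1 (10 * i + j)) (Nat.shiftLeft 1 (10 * j + i)))

/-- `f n`, in a form that makes the kernel evaluate `n` first. -/
def evalFirst {α : Sort*} (n : ℕ) (f : ℕ → α) : α :=
  Nat.rec (f 0) (fun m _ => f (m + 1)) n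

/-! ### Search over breadth-first labellings -/

/-- Join the vertex `c` to `d` new vertices, labelled from `k` on. -/
def searchNew (p : ℕ → ℕ → Bool) (c : ℕ) : ℕ → ℕ → ℕ → Bool
  | 0, k, E => p E k
  -- An eleventh label is impossible, so such a branch passes vacuously.
  | d + 1, k, E => Nat.beq k 10 || searchNew p c d (k + 1) (setEntry E c k)

/-- Try all ways of choosing `d` further neighbours of the vertex `c`, among the `m` labelled
vertices from `j` on and new vertices. The adjacencies to labels `j ≤ c` are given by `E`. -/
def searchRow (p : ℕ → ℕ → Bool) (c k : ℕ) : ℕ → ℕ → ℕ → ℕ → Bool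
  | 0, _, d, E => searchNew p c d k E
  | m + 1, j, d, E =>
    bif Nat.ble j c then
      bif entry E c j then
        match d with
        -- Here the degree would exceed three: again a vacuous pass.
        | 0 => true
        | d + 1 => searchRow p c k m (j + 1) d E
      else searchRow p c k m (j + 1) d E
    else searchRow p c k m (j + 1) d E &&
      match d with
      | 0 => true
      | d + 1 => searchRow p c k m (j + 1) d (setEntry E c j)

/-- `good` holds for all completions to a connected cubic graph of order ten of a breadth-first
labelling that has reached `k` labels, where `E` holds the adjacencies of the first `c` labels. -/
def search (good : ℕ → Bool) : ℕ → ℕ → ℕ → ℕ → Bool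
  | 0, _, _, _ => false
  | n + 1, E, c, k => evalFirst E fun E =>
    -- When `c = k` the labels fill a component; connectedness rules out fewer than ten.
    bif Nat.beq c k then !Nat.beq k 10 || good E
    else searchRow (fun E k => search good n E (c + 1) k) c k k 0 3 E

/-! ### Models of `K₈⁻` on labels -/

/-- Some label in `b` is `r`-related to some label in `c`. -/
def touches (r : ℕ → ℕ → Bool) (b c : List ℕ) : Bool :=
  anyOf b fun i => anyOf c fun j => r i j

/-- Every label of the list is `r`-related to an earlier one or to a label in `seen`. -/
def chained (r : ℕ → ℕ → Bool) : List ℕ → List ℕ → Bool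
  | _, [] => true
  | seen, a :: l => touches r seen [a] && chained r (a :: seen) l

/-- A bag of labels that is connected when its labels are added in the given order. -/
def bagConnected (r : ℕ → ℕ → Bool) : List ℕ → Bool
  | [] => false
  | a :: l => chained r [a] l

/-- Any two of the bags touch. -/
def clique (r : ℕ → ℕ → Bool) : List (List ℕ) → Bool
  | [] => true
  | b :: l => allOf l (touches r b) && clique r l

/-- The bags are connected, and any two of them touch, with the possible exception of the first
two. -/
def isModel (r : ℕ → ℕ → Bool) : List (List ℕ) → Bool
  | b₀ :: b₁ :: l => clique r (b₀ :: l) && allOf l (touches r b₁) &&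
      allOf (b₀ :: b₁ :: l) (bagConnected r)
  | _ => false

/-- Eight disjoint bags of labels less than `12`. -/
def wellFormed (W : List (List ℕ)) : Bool :=
  W.length == 8 && decide W.flatten.Nodup && W.flatten.all (· < 12)

/-- Adjacencies between labels: the labels below `10` are the neighbours of a vertex `x`, with `E`
giving the *non*-adjacencies between them, `11` stands for `x`, and `10` for a connected set
that has neighbours with the labels in `A`. -/
def labelAdj (E : ℕ) (A : List ℕ) (i j : ℕ) : Bool :=
  bif Nat.ble i 9 then
    bif Nat.ble j 9 then !Nat.beq i j && !entry E i j
    else bif Nat.beq j 10 then anyOf A (Nat.beq i) else true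
  else bif Nat.ble j 9 then
    bif Nat.beq i 10 then anyOf A (Nat.beq j) else true
  -- The labels `10` and `11` are not related, as `K` avoids `N[x]`; a bag containing `10` must
  -- reach `11` through a neighbour of `x`.
  else false

/-- Label models of `K₈⁻` that avoid the label `10`, each with a mask of adjacencies that
exclude it. -/
def nearModels : List (ℕ × List (List ℕ)) :=
  [(0x600000200400180001200, [[3], [8], [1], [2], [0, 9], [4, 6], [5, 7], [11]]),
   (0x600000100800180001200, [[3], [8], [1], [2], [0, 9], [4, 7], [5, 6], [11]]),
   (0x180001800000400800001100, [[7], [9], [1], [2], [0, 8], [3, 5], [4, 6], [11]]),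
   (0x440000000044004008010010, [[5], [9], [0], [4], [1, 6], [2, 7], [3, 8], [11]]),
   (0x102000800810240200, [[2], [6], [1], [8], [0, 9], [3, 5], [4, 7], [11]]),
   (0x102200000410240200, [[2], [6], [1], [8], [0, 9], [3, 4], [5, 7], [11]]),
   (0x10400104000410080040, [[5], [7], [0], [6], [1, 9], [2, 8], [3, 4], [11]]),
   (0x102002021040210, [[0], [2], [4], [9], [1, 8], [3, 7], [5, 6], [11]]),
   (0x440000000044002010010010, [[5], [9], [0], [4], [1, 6], [2, 8], [3, 7], [11]]),
   (0x3000000002000c0000810100, [[4], [9], [2], [3], [0, 8], [1, 6], [5, 7], [11]]),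
   (0x40400404000420010100, [[5], [7], [0], [8], [1, 6], [2, 9], [3, 4], [11]]),
   (0x801001022020220, [[0], [2], [5], [9], [1, 7], [3, 6], [4, 8], [11]]),
   (0x180001800000201000001100, [[7], [9], [1], [2], [0, 8], [3, 6], [4, 5], [11]]),
   (0x8100081000000801080080, [[6], [8], [0], [7], [1, 9], [2, 4], [3, 5], [11]]),
   (0x804000080010300c0, [[0], [1], [6], [7], [2, 4], [3, 9], [5, 8], [11]]),
   (0x3000000001000c0000820100, [[4], [9], [2], [3], [0, 8], [1, 7], [5, 6], [11]]),
   (0x402001021020210, [[0], [2], [4], [9], [1, 7], [3, 6], [5, 8], [11]]),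
   (0x4110400000000801080040, [[7], [8], [0], [6], [1, 9], [2, 4], [3, 5], [11]]),
   (0x4110400000000402080040, [[7], [8], [0], [6], [1, 9], [2, 5], [3, 4], [11]]),
   (0x4040040400000000402010100, [[7], [9], [0], [8], [1, 6], [2, 5], [3, 4], [11]]),
   (0x2004028200400a0, [[0], [3], [5], [7], [1, 8], [2, 9], [4, 6], [11]]),
   (0x40000000400820060180, [[0], [1], [7], [8], [2, 9], [3, 5], [4, 6], [11]]),
   (0x100802420040090, [[0], [3], [4], [7], [1, 8], [2, 9], [5, 6], [11]]),
   (0x200000200c10020030, [[0], [3], [4], [5], [1, 7], [2, 8], [6, 9], [11]]),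
   (0x4400044008010010010, [[5], [7], [0], [4], [1, 6], [2, 8], [3, 9], [11]]),
   (0xa400800000a02200, [[2], [6], [1], [3], [0, 9], [4, 7], [5, 8], [11]]),
   (0x800020040020300c0, [[0], [1], [6], [7], [2, 5], [3, 8], [4, 9], [11]]),
   (0x800882010022040, [[1], [4], [3], [7], [0, 6], [2, 8], [5, 9], [11]]),
   (0x80400002011002040200, [[4], [7], [0], [9], [1, 8], [2, 5], [3, 6], [11]]),
   (0x1100000044002020010010, [[5], [8], [0], [4], [1, 6], [2, 9], [3, 7], [11]]),
   (0xa201000000a02200, [[2], [6], [1], [3], [0, 9], [4, 8], [5, 7], [11]]),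
   (0x82001002082020200, [[3], [6], [1], [7], [0, 9], [2, 5], [4, 8], [11]]),
   (0x201002010808040200, [[4], [6], [0], [9], [1, 8], [2, 7], [3, 5], [11]]),
   (0x400882020022040, [[1], [4], [3], [7], [0, 6], [2, 9], [5, 8], [11]]),
   (0x80400002010810010200, [[4], [7], [0], [9], [1, 6], [2, 8], [3, 5], [11]]),
   (0x2004028100800a0, [[0], [3], [5], [7], [1, 9], [2, 8], [4, 6], [11]]),
   (0x808000040010300c0, [[0], [1], [6], [7], [2, 4], [3, 8], [5, 9], [11]]),
   (0x201804000408040200, [[5], [6], [0], [9], [1, 8], [2, 7], [3, 4], [11]]),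
   (0x201002010810020200, [[4], [6], [0], [9], [1, 7], [2, 8], [3, 5], [11]]),
   (0x201041010041200, [[1], [4], [2], [8], [0, 9], [3, 6], [5, 7], [11]]),
   (0x202041020081100, [[1], [4], [2], [9], [0, 8], [3, 6], [5, 7], [11]]),
   (0x2400200000000902020010, [[3], [8], [2], [5], [0, 4], [1, 7], [6, 9], [11]]),
   (0x40400001010820010100, [[4], [7], [0], [8], [1, 6], [2, 9], [3, 5], [11]]),
   (0x80400804001001040200, [[5], [7], [0], [9], [1, 8], [2, 4], [3, 6], [11]]),
   (0x81204000410080080, [[5], [6], [0], [7], [1, 9], [2, 8], [3, 4], [11]]),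
   (0x101404008001020100, [[5], [6], [0], [8], [1, 7], [2, 4], [3, 9], [11]]),
   (0x40400404008001010100, [[5], [7], [0], [8], [1, 6], [2, 4], [3, 9], [11]]),
   (0x121400008001020120, [[6], [3, 9], [0], [5], [8], [1, 7], [2, 4], [11]])]

/-- Label models of `K₈⁻` that use the label `10`, each with a mask of adjacencies that
exclude it. -/
def farModels : List (ℕ × List (List ℕ)) :=
  [(0x200000800000008000300c0, [[0], [1], [6], [7], [3, 5], [8, 9], [10, 2, 4], [11]]),
   (0x200000800000004000300c0, [[0], [1], [6], [7], [3, 4], [8, 9], [10, 5, 2], [11]]),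
   (0x200000800000000010c0300, [[0], [1], [8], [9], [2, 4], [6, 7], [10, 3, 5], [11]]),
   (0x200000800000000020c0300, [[0], [1], [8], [9], [2, 5], [6, 7], [10, 4, 3], [11]]),
   (0x20000080000200000830000, [[1], [4, 5], [6], [7], [2, 3], [8, 9], [10, 0], [11]]),
   (0x200000800002000008000c0, [[0], [2, 3], [6], [7], [4, 5], [8, 9], [10, 1], [11]]),
   (0x20000000000200030010300, [[0], [2], [8], [9], [1, 6], [4, 5], [10, 7, 3], [11]])]

/-- The bags `W.2` form a model. The quick test that `E` avoids the mask `W.1` comes first. -/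
def isMaskedModel (E : ℕ) (A : List ℕ) (W : ℕ × List (List ℕ)) : Bool :=
  bif Nat.beq (Nat.land E W.1) 0 then isModel (labelAdj E A) W.2 else false

/-- One of the listed models is present, whichever six labels are adjacent to the label `10`. -/
def hasListedModel (E : ℕ) : Bool :=
  anyOf nearModels (isMaskedModel E []) ||
    allOf ((List.range 10).sublistsLen 6) fun A => anyOf farModels (isMaskedModel E A)

/-- Disjointness of the bags does not depend on the graph, so it is checked once, outside the
search. -/
theorem wellFormed_nearModels : nearModels.all fun W => wellFormed W.2 := by decide +kernel

theorem wellFormed_farModels : farModels.all fun W => wellFormed W.2 := by decide +kernel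

theorem anyOf_eq_any {α : Type*} (l : List α) (p : α → Bool) : anyOf l p = l.any p := by
  induction l with
  | nil => rfl
  | cons a l ih =>
    rw [List.any_cons, ← ih]
    change (bif p a then true else anyOf l p) = _
    cases p a <;> rfl

theorem allOf_eq_all {α : Type*} (l : List α) (p : α → Bool) : allOf l p = l.all p := by
  induction l with
  | nil => rfl
  | cons a l ih =>
    rw [List.all_cons, ← ih]
    change (bif p a then allOf l p else false) = _
    cases p a <;> rfl

theorem evalFirst_eq {α : Sort*} (n : ℕ) (f : ℕ → α) : evalFirst n f = f n := by
  cases n <;> rfl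

theorem entry_eq_testBit (E i j : ℕ) : entry E i j = E.testBit (10 * i + j) := by
  have h : entry E i j = Nat.beq ((E >>> (10 * i + j)) &&& 1) 1 := rfl
  rw [h, Nat.and_one_is_mod, Nat.testBit, Nat.and_comm, Nat.and_one_is_mod]
  rcases Nat.mod_two_eq_zero_or_one (E >>> (10 * i + j)) with h | h <;> rw [h] <;> rfl

theorem entry_setEntry {E a b c d : ℕ} (hb : b < 10) (hc : c < 10) (hd : d < 10) :
    entry (setEntry E c d) a b = true ↔
      entry E a b = true ∨ (a = c ∧ b = d) ∨ (a = d ∧ b = c) := by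
  have h : setEntry E c d = E ||| ((1 <<< (10 * c + d)) ||| (1 <<< (10 * d + c))) := rfl
  rw [entry_eq_testBit, entry_eq_testBit, h, Nat.testBit_or, Nat.testBit_or, Nat.one_shiftLeft,
    Nat.one_shiftLeft, Nat.testBit_two_pow, Nat.testBit_two_pow]
  simp only [Bool.or_eq_true, decide_eq_true_eq]
  refine or_congr_right (or_congr ?_ ?_) <;> omega

/-! ### Soundness of the search -/

section Search

variable {U : Type*} {C : SimpleGraph U}

/-- The vertices `f 0, …, f (k - 1)` are distinct, those before `f c` have all their neighbours
among them, and `E` holds the adjacencies of the latter and those between `f c` and the vertices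
before `f j`. -/
structure IsLabelling (C : SimpleGraph U) (f : ℕ → U) (E c j k : ℕ) : Prop where
  pos : 0 < k
  inj : Set.InjOn f (Set.Iio k)
  entry_iff : ∀ a < 10, ∀ b < 10, (entry E a b = true ↔ a < k ∧ b < k ∧
    (a < c ∨ b < c ∨ (a = c ∧ b < j) ∨ (b = c ∧ a < j)) ∧ C.Adj (f a) (f b))
  closed : ∀ a < c, ∀ w, C.Adj (f a) w → ∃ b < k, f b = w

namespace IsLabelling

variable {f : ℕ → U} {E c j k : ℕ}

theorem le_ten [Finite U] (hU : Nat.card U = 10) (h : IsLabelling C f E c j k) : k ≤ 10 := by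
  have h1 := Set.ncard_le_card (f '' Set.Iio k)
  rw [h.inj.ncard_image, hU, Set.ncard_Iio_nat] at h1
  exact h1

/-- For `j < c` the pair was already recorded in row `j`; otherwise there is no edge to record. -/
theorem skip (h : IsLabelling C f E c j k) (hj : j < c ∨ ¬ C.Adj (f c) (f j)) :
    IsLabelling C f E c (j + 1) k where
  pos := h.pos
  inj := h.inj
  closed := h.closed
  entry_iff a ha b hb := by
    rw [h.entry_iff a ha b hb]
    refine and_congr_right fun _ => and_congr_right fun _ => and_congr_left fun hab => ?_
    constructor
    · omega
    · rintro (h1 | h1 | ⟨rfl, h1⟩ | ⟨rfl, h1⟩)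
      · exact Or.inl h1
      · exact Or.inr (Or.inl h1)
      · rcases Nat.lt_succ_iff_lt_or_eq.1 h1 with h1 | rfl
        · omega
        · rcases hj with hj | hj
          · omega
          · exact absurd hab hj
      · rcases Nat.lt_succ_iff_lt_or_eq.1 h1 with h1 | rfl
        · omega
        · rcases hj with hj | hj
          · omega
          · exact absurd hab.symm hj

theorem join (h : IsLabelling C f E c j k) (hk : k ≤ 10) (hc : c < k) (hj : j < k)
    (hadj : C.Adj (f c) (f j)) : IsLabelling C f (setEntry E c j) c (j + 1) k where
  pos := h.pos
  inj := h.inj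
  closed := h.closed
  entry_iff a ha b hb := by
    rw [entry_setEntry hb (by omega) (by omega), h.entry_iff a ha b hb]
    constructor
    · rintro (⟨h1, h2, h3, h4⟩ | ⟨rfl, rfl⟩ | ⟨rfl, rfl⟩)
      · exact ⟨h1, h2, by omega, h4⟩
      · exact ⟨hc, hj, by omega, hadj⟩
      · exact ⟨hj, hc, by omega, hadj.symm⟩
    · rintro ⟨h1, h2, h3, h4⟩
      by_cases h5 : (a = c ∧ b = j) ∨ (a = j ∧ b = c)
      · exact Or.inr h5
      · exact Or.inl ⟨h1, h2, by omega, h4⟩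

/-- The matrix can stay as it is: the vertices before `f c` have all their neighbours labelled, so
the new vertex is adjacent to none of them, and `j ≤ k` keeps its pair with `f c` still undecided.
-/
theorem addVertex (h : IsLabelling C f E c j k) (hc : c < k) (hj : j ≤ k) {w : U}
    (hw : ∀ b < k, f b ≠ w) : IsLabelling C (Function.update f k w) E c j (k + 1) where
  pos := Nat.succ_pos k
  inj a ha b hb hab := by
    simp only [Set.mem_Iio, Nat.lt_succ_iff_lt_or_eq] at ha hb
    rcases ha with ha | rfl <;> rcases hb with hb | rfl
    · rw [Function.update_of_ne ha.ne, Function.update_of_ne hb.ne] at hab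
      exact h.inj ha hb hab
    · rw [Function.update_of_ne ha.ne, Function.update_self] at hab
      exact absurd hab (hw a ha)
    · rw [Function.update_of_ne hb.ne, Function.update_self] at hab
      exact absurd hab.symm (hw b hb)
    · rfl
  closed a ha v hv := by
    rw [Function.update_of_ne (by omega)] at hv
    obtain ⟨b, hb, hbv⟩ := h.closed a ha v hv
    exact ⟨b, by omega, by rwa [Function.update_of_ne hb.ne]⟩
  entry_iff a ha b hb := by
    rw [h.entry_iff a ha b hb]
    constructor
    · rintro ⟨h1, h2, h3, h4⟩
      exact ⟨by omega, by omega, h3, by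
        rwa [Function.update_of_ne h1.ne, Function.update_of_ne h2.ne]⟩
    · rintro ⟨h1, h2, h3, h4⟩
      rcases Nat.lt_succ_iff_lt_or_eq.1 h1 with h1 | rfl <;>
        rcases Nat.lt_succ_iff_lt_or_eq.1 h2 with h2 | rfl
      · rw [Function.update_of_ne h1.ne, Function.update_of_ne h2.ne] at h4
        exact ⟨h1, h2, h3, h4⟩
      · rw [Function.update_of_ne h1.ne, Function.update_self] at h4
        obtain ⟨b, hb, hbw⟩ := h.closed a (by omega) w h4
        exact absurd hbw (hw b hb)
      · rw [Function.update_of_ne h2.ne, Function.update_self] at h4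
        obtain ⟨a, ha, haw⟩ := h.closed b (by omega) w h4.symm
        exact absurd haw (hw a ha)
      · exact absurd h4 (C.irrefl)

theorem close (h : IsLabelling C f E c k k)
    (hn : ∀ w, C.Adj (f c) w → ∃ b < k, f b = w) : IsLabelling C f E (c + 1) 0 k where
  pos := h.pos
  inj := h.inj
  closed a ha := by
    rcases Nat.lt_succ_iff_lt_or_eq.1 ha with ha | rfl
    · exact h.closed a ha
    · exact hn
  entry_iff a ha b hb := by
    rw [h.entry_iff a ha b hb]
    refine and_congr_right fun _ => and_congr_right fun _ => and_congr_left fun hab => ?_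
    omega

end IsLabelling

/-- The neighbours of `f c` that are not among `f 0, …, f (j - 1)`. -/
def remaining (C : SimpleGraph U) (f : ℕ → U) (c j : ℕ) : Set U :=
  C.neighborSet (f c) \ f '' Set.Iio j

theorem mem_remaining {f : ℕ → U} {c j : ℕ} {w : U} :
    w ∈ remaining C f c j ↔ C.Adj (f c) w ∧ ∀ b < j, f b ≠ w := by
  simp [remaining]

theorem remaining_succ_of_not_adj {f : ℕ → U} {c j : ℕ} (h : ¬ C.Adj (f c) (f j)) :
    remaining C f c (j + 1) = remaining C f c j := by
  ext w
  rw [mem_remaining, mem_remaining]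
  refine and_congr_right fun hw => ⟨fun h1 b hb => h1 b (by omega), fun h1 b hb => ?_⟩
  rcases Nat.lt_succ_iff_lt_or_eq.1 hb with hb | rfl
  · exact h1 b hb
  · rintro rfl
    exact h hw

theorem ncard_remaining_of_adj [Finite U] {f : ℕ → U} {c j : ℕ} (h : C.Adj (f c) (f j))
    (hj : ∀ b < j, f b ≠ f j) :
    (remaining C f c j).ncard = (remaining C f c (j + 1)).ncard + 1 := by
  have h1 : remaining C f c j = insert (f j) (remaining C f c (j + 1)) := by
    ext w
    rw [Set.mem_insert_iff, mem_remaining, mem_remaining]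
    constructor
    · rintro ⟨hw, h2⟩
      by_cases h3 : w = f j
      · exact Or.inl h3
      · refine Or.inr ⟨hw, fun b hb => ?_⟩
        rcases Nat.lt_succ_iff_lt_or_eq.1 hb with hb | rfl
        · exact h2 b hb
        · exact Ne.symm h3
    · rintro (rfl | ⟨hw, h2⟩)
      · exact ⟨h, hj⟩
      · exact ⟨hw, fun b hb => h2 b (by omega)⟩
  rw [h1, Set.ncard_insert_of_notMem fun h2 => (mem_remaining.1 h2).2 j (by omega) rfl]

/-- The remaining neighbours are unlabelled and their order is immaterial, so any of them may
receive the label `k`. This is the freedom that fixes the labelling. -/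
theorem searchNew_sound [Finite U] (hU : Nat.card U = 10) {p : ℕ → ℕ → Bool} {c d k E : ℕ}
    {f : ℕ → U} (hs : searchNew p c d k E = true) (h : IsLabelling C f E c k k) (hc : c < k)
    (hd : (remaining C f c k).ncard = d) :
    ∃ f' E' k', IsLabelling C f' E' (c + 1) 0 k' ∧ c < k' ∧ p E' k' = true := by
  induction d generalizing k E f with
  | zero =>
    refine ⟨f, E, k, h.close fun w hw => ?_, hc, hs⟩
    by_contra! h1
    rw [Set.ncard_eq_zero] at hd
    exact Set.notMem_empty w (hd ▸ mem_remaining.2 ⟨hw, h1⟩)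
  | succ d ih =>
    obtain ⟨w, hw⟩ : (remaining C f c k).Nonempty := by
      rw [← Set.ncard_pos, hd]
      exact Nat.succ_pos d
    obtain ⟨hcw, hw⟩ := mem_remaining.1 hw
    have h1 := h.addVertex hc le_rfl hw
    -- This bound on the extended labelling excludes the vacuous pass at `k = 10`.
    have hk := h1.le_ten hU
    have hcw' : C.Adj (Function.update f k w c) (Function.update f k w k) := by
      rwa [Function.update_of_ne hc.ne, Function.update_self]
    have h2 : remaining C (Function.update f k w) c k = remaining C f c k := by
      ext v
      rw [mem_remaining, mem_remaining, Function.update_of_ne hc.ne]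
      refine and_congr_right fun _ => forall₂_congr fun b hb => ?_
      rw [Function.update_of_ne hb.ne]
    have h3 := ncard_remaining_of_adj hcw' fun b hb => by
      rw [Function.update_of_ne hb.ne, Function.update_self]
      exact hw b hb
    rw [h2, hd] at h3
    refine ih ?_ (h1.join hk (by omega) (by omega) hcw') (by omega) (by omega)
    simp only [searchNew, Bool.or_eq_true, Nat.beq_eq] at hs
    exact hs.resolve_left (by omega)

/-- The true adjacency of `f c` and `f j` selects the branch to follow, while `d` counts the
neighbours of `f c` not yet met. -/
theorem searchRow_sound [Finite U] (hU : Nat.card U = 10) {p : ℕ → ℕ → Bool} {c k m j d E : ℕ}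
    {f : ℕ → U} (hs : searchRow p c k m j d E = true) (h : IsLabelling C f E c j k) (hc : c < k)
    (hm : j + m = k) (hd : (remaining C f c j).ncard = d) :
    ∃ f' E' k', IsLabelling C f' E' (c + 1) 0 k' ∧ c < k' ∧ p E' k' = true := by
  induction m generalizing j d E with
  | zero =>
    obtain rfl : j = k := hm
    exact searchNew_sound hU hs h hc hd
  | succ m ih =>
    have hk := h.le_ten hU
    rw [searchRow.eq_def] at hs
    dsimp only at hs
    by_cases hadj : C.Adj (f c) (f j)
    · have h1 := ncard_remaining_of_adj hadj fun b hb hbj =>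
        hb.ne (h.inj (Set.mem_Iio.2 (by omega)) (Set.mem_Iio.2 (by omega)) hbj)
      -- The neighbour `f j` is still to be counted, so the vacuous case `d = 0` does not arise.
      obtain ⟨d, rfl⟩ : ∃ d', d = d' + 1 := ⟨_, hd.symm.trans h1⟩
      by_cases hjc : j < c
      · have he : entry E c j = true :=
          (h.entry_iff c (by omega) j (by omega)).2 ⟨hc, by omega, by omega, hadj⟩
        rw [Nat.ble_eq_true_of_le hjc.le, he] at hs
        exact ih hs (h.skip (Or.inl hjc)) (by omega) (by omega)
      · have hjc' : c ≠ j := by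
          rintro rfl
          exact C.irrefl hadj
        have hb : Nat.ble j c = false := by
          rw [Bool.eq_false_iff, ne_eq, Nat.ble_eq]
          omega
        rw [hb] at hs
        exact ih (Bool.and_eq_true_iff.1 hs).2 (h.join hk hc (by omega) hadj) (by omega) (by omega)
    · rw [← remaining_succ_of_not_adj hadj] at hd
      refine ih ?_ (h.skip (Or.inr hadj)) (by omega) hd
      have he : entry E c j = false ∨ c < j := by
        by_contra! h1
        rw [ne_eq, Bool.not_eq_false, h.entry_iff c (by omega) j (by omega)] at h1
        exact hadj h1.1.2.2.2
      cases hb : Nat.ble j c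
      · rw [hb] at hs
        exact (Bool.and_eq_true_iff.1 hs).1
      · rw [Nat.ble_eq] at hb
        rw [Nat.ble_eq_true_of_le hb, he.resolve_right (by omega)] at hs
        exact hs

/-- With `c = k` the labelled set is closed under adjacency, hence is everything by connectedness.
-/
theorem IsLabelling.eq_ten [Finite U] (hU : Nat.card U = 10) (hC : C.Connected) {f : ℕ → U}
    {E j k : ℕ} (h : IsLabelling C f E k j k) : k = 10 := by
  have h1 : ∀ w, ∃ b < k, f b = w := by
    intro w
    have h2 := hC.preconnected (f 0) w
    rw [SimpleGraph.reachable_iff_reflTransGen] at h2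
    induction h2 with
    | refl => exact ⟨0, h.pos, rfl⟩
    | tail _ hvw ih =>
      obtain ⟨b, hb, rfl⟩ := ih
      exact h.closed b hb _ hvw
  have h2 : f '' Set.Iio k = Set.univ := by
    ext w
    simpa using h1 w
  rw [← Set.ncard_Iio_nat k, ← h.inj.ncard_image, h2, Set.ncard_univ, hU]

theorem search_sound [Finite U] (hU : Nat.card U = 10) (hC : C.Connected)
    (h3 : ∀ v, (C.neighborSet v).ncard = 3) {good : ℕ → Bool} {n E c k : ℕ} {f : ℕ → U}
    (hs : search good n E c k = true) (h : IsLabelling C f E c 0 k) (hc : c ≤ k) :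
    ∃ f' E', IsLabelling C f' E' 10 0 10 ∧ good E' = true := by
  induction n generalizing E c k f with
  | zero => exact absurd hs Bool.false_ne_true
  | succ n ih =>
    rw [search, evalFirst_eq] at hs
    rcases hc.eq_or_lt with rfl | hc
    · obtain rfl := h.eq_ten hU hC
      exact ⟨f, E, h, hs⟩
    · have hb : Nat.beq c k = false := by
        rw [Bool.eq_false_iff, ne_eq, Nat.beq_eq]
        omega
      rw [hb] at hs
      obtain ⟨f', E', k', h1, h2, h4⟩ := searchRow_sound hU hs h hc (Nat.zero_add k)
        (by simpa [remaining] using h3 (f c))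
      exact ih h4 h1 h2

/-- Every connected cubic graph of order ten has a labelling whose adjacency matrix passes a test
that succeeds on all leaves of the search. -/
theorem exists_labelling [Finite U] (hU : Nat.card U = 10) (hC : C.Connected)
    (h3 : ∀ v, (C.neighborSet v).ncard = 3) {good : ℕ → Bool} {n : ℕ}
    (hs : search good n 0 0 1 = true) :
    ∃ (f : ℕ → U) (E : ℕ), Set.InjOn f (Set.Iio 10) ∧
      (∀ i < 10, ∀ j < 10, entry E i j = true ↔ C.Adj (f i) (f j)) ∧ good E = true := by
  obtain ⟨v⟩ := hC.nonempty
  obtain ⟨f, E, h, hg⟩ := search_sound (f := fun _ => v) hU hC h3 hs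
    { pos := one_pos
      inj := fun a ha b hb _ => by
        simp only [Set.mem_Iio] at ha hb
        omega
      entry_iff := fun a _ b _ => by simp [entry_eq_testBit]
      closed := fun a ha => absurd ha (Nat.not_lt_zero a) } (Nat.zero_le 1)
  refine ⟨f, E, h.inj, fun i hi j hj => ?_, hg⟩
  rw [h.entry_iff i hi j hj]
  exact ⟨fun h => h.2.2.2, fun h => ⟨hi, hj, Or.inl hi, h⟩⟩

end Search

/-! ### From label models to minors -/

theorem touches_iff {r : ℕ → ℕ → Bool} {b c : List ℕ} :
    touches r b c = true ↔ ∃ i ∈ b, ∃ j ∈ c, r i j = true := by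
  simp [touches, anyOf_eq_any]

theorem pairwise_of_clique {r : ℕ → ℕ → Bool} {l : List (List ℕ)} (h : clique r l = true) :
    l.Pairwise fun b c => touches r b c = true := by
  induction l with
  | nil => exact List.Pairwise.nil
  | cons b l ih =>
    simp only [clique, allOf_eq_all, Bool.and_eq_true, List.all_eq_true] at h
    exact List.pairwise_cons.2 ⟨h.1, ih h.2⟩

theorem touches_of_isModel {r : ℕ → ℕ → Bool} {W : List (List ℕ)} (h : isModel r W = true)
    {i j : ℕ} (hij : i < j) (hj : j < W.length) (h01 : ¬ (i = 0 ∧ j = 1)) :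
    touches r W[i] W[j] = true := by
  match W, h with
  | b₀ :: b₁ :: l, h =>
    simp only [isModel, allOf_eq_all, Bool.and_eq_true, List.all_eq_true] at h
    obtain ⟨h₀, hl⟩ := List.pairwise_cons.1 (pairwise_of_clique h.1.1)
    match i, j with
    | 0, j + 2 => exact h₀ _ (List.getElem_mem _)
    | 1, j + 2 => exact h.1.2 _ (List.getElem_mem _)
    | i + 2, j + 2 => exact List.pairwise_iff_getElem.1 hl i j _ _ (by omega)

theorem bagConnected_of_isModel {r : ℕ → ℕ → Bool} {W : List (List ℕ)} (h : isModel r W = true) :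
    ∀ b ∈ W, bagConnected r b = true := by
  match W, h with
  | b₀ :: b₁ :: l, h =>
    simp only [isModel, allOf_eq_all, Bool.and_eq_true] at h
    exact List.all_eq_true.1 h.2

section Transfer

variable {V : Type*} {G : SimpleGraph V} {S : ℕ → Set V} {r : ℕ → ℕ → Bool}

/-- The vertices represented by the labels in `b`. -/
def bagSet (S : ℕ → Set V) (b : List ℕ) : Set V :=
  {v | ∃ i ∈ b, v ∈ S i}

theorem connected_bagSet_of_chained {n : ℕ} (hS : ∀ i < n, (G.induce (S i)).Connected)
    (hr : ∀ i < n, ∀ j < n, r i j = true → ∃ u ∈ S i, ∃ v ∈ S j, G.Adj u v) {l : List ℕ}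
    (hl : ∀ i ∈ l, i < n) {seen : List ℕ} (hseen : ∀ i ∈ seen, i < n)
    (hc : (G.induce (bagSet S seen)).Connected) (h : chained r seen l = true) :
    (G.induce (bagSet S (seen ++ l))).Connected := by
  induction l generalizing seen with
  | nil => rwa [List.append_nil]
  | cons a l ih =>
    rw [chained, Bool.and_eq_true, touches_iff] at h
    obtain ⟨⟨i, hi, a', ha', hia⟩, h⟩ := h
    obtain rfl := List.mem_singleton.1 ha'
    have ha := hl a' List.mem_cons_self
    obtain ⟨u, hu, v, hv, huv⟩ := hr i (hseen i hi) a' ha hia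
    have h1 := SimpleGraph.connected_induce_union hc.preconnected (hS a' ha).preconnected
      (show u ∈ bagSet S seen from ⟨i, hi, hu⟩) hv huv
    have h2 : bagSet S seen ∪ S a' = bagSet S (a' :: seen) := by
      ext w
      simp [bagSet, or_comm]
    have h3 : bagSet S (seen ++ a' :: l) = bagSet S (a' :: seen ++ l) := by
      ext w
      simp only [bagSet, List.mem_append, List.mem_cons, Set.mem_ofPred_eq]
      exact exists_congr fun _ => and_congr_left fun _ => by tauto
    rw [h3]
    exact ih (fun i hi => hl i (List.mem_cons_of_mem _ hi))
      (List.forall_mem_cons.2 ⟨ha, hseen⟩) (h2 ▸ h1) h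

theorem connected_bagSet {n : ℕ} (hS : ∀ i < n, (G.induce (S i)).Connected)
    (hr : ∀ i < n, ∀ j < n, r i j = true → ∃ u ∈ S i, ∃ v ∈ S j, G.Adj u v) {b : List ℕ}
    (hb : ∀ i ∈ b, i < n) (h : bagConnected r b = true) :
    (G.induce (bagSet S b)).Connected := by
  match b, h with
  | a :: l, h =>
    have h1 : bagSet S [a] = S a := by
      ext w
      simp [bagSet]
    exact connected_bagSet_of_chained hS hr (seen := [a])
      (fun i hi => hb i (List.mem_cons_of_mem _ hi)) (fun i hi => hb i (by simp_all))
      (h1 ▸ hS a (hb a List.mem_cons_self)) h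

/-- Each bag becomes the union of the sets its labels stand for. The first two bags, exempt from
touching, match the removed edge `s(0, 1)`. -/
theorem hasMinor_of_isModel (hS : ∀ i < 12, (G.induce (S i)).Connected)
    (hd : ∀ i < 12, ∀ j < 12, i ≠ j → Disjoint (S i) (S j))
    (hr : ∀ i < 12, ∀ j < 12, r i j = true → ∃ u ∈ S i, ∃ v ∈ S j, G.Adj u v)
    {W : List (List ℕ)} (hW : wellFormed W = true) (h : isModel r W = true) :
    G.HasMinor completeEightMinusEdge := by
  simp only [wellFormed, Bool.and_eq_true, beq_iff_eq, decide_eq_true_eq, List.all_eq_true] at hW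
  obtain ⟨⟨hlen, hnodup⟩, hlt⟩ := hW
  have hlt' : ∀ b ∈ W, ∀ i ∈ b, i < 12 := fun b hb i hi =>
    hlt i (List.mem_flatten.2 ⟨b, hb, hi⟩)
  have hconn : ∀ b ∈ W, (G.induce (bagSet S b)).Connected := fun b hb =>
    connected_bagSet hS hr (hlt' b hb) (bagConnected_of_isModel h b hb)
  have hmem : ∀ h : Fin 8, W[(h : ℕ)] ∈ W := fun h => List.getElem_mem _
  have hdisj : ∀ h₁ h₂ : Fin 8, h₁ < h₂ →
      Disjoint (bagSet S W[(h₁ : ℕ)]) (bagSet S W[(h₂ : ℕ)]) := by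
    intro h₁ h₂ hh
    have h3 := List.pairwise_iff_getElem.1 (List.nodup_flatten.1 hnodup).2 h₁ h₂ (by omega)
      (by omega) hh
    rw [Set.disjoint_left]
    rintro v ⟨i, hi, hvi⟩ ⟨j, hj, hvj⟩
    have hij : i ≠ j := by
      rintro rfl
      exact h3 hi hj
    exact Set.disjoint_left.1 (hd i (hlt' _ (hmem h₁) i hi) j (hlt' _ (hmem h₂) j hj) hij) hvi hvj
  have hadj : ∀ h₁ h₂ : Fin 8, h₁ < h₂ → completeEightMinusEdge.Adj h₁ h₂ →
      ∃ u ∈ bagSet S W[(h₁ : ℕ)], ∃ v ∈ bagSet S W[(h₂ : ℕ)], G.Adj u v := by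
    intro h₁ h₂ hh hE
    have h01 : ¬ ((h₁ : ℕ) = 0 ∧ (h₂ : ℕ) = 1) := by
      rintro ⟨h3, h4⟩
      obtain rfl : h₁ = 0 := Fin.ext h3
      obtain rfl : h₂ = 1 := Fin.ext h4
      simp [completeEightMinusEdge] at hE
    obtain ⟨i, hi, j, hj, hij⟩ := touches_iff.1 (touches_of_isModel h hh (by omega) h01)
    obtain ⟨u, hu, v, hv, huv⟩ := hr i (hlt' _ (hmem h₁) i hi) j (hlt' _ (hmem h₂) j hj) hij
    exact ⟨u, ⟨i, hi, hu⟩, v, ⟨j, hj, hv⟩, huv⟩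
  refine ⟨fun h => bagSet S W[(h : ℕ)], fun h => ?_, fun h₁ h₂ hne => ?_,
    fun h => hconn _ (hmem h), fun h₁ h₂ hE => ?_⟩
  · exact Set.nonempty_coe_sort.1 (hconn _ (hmem h)).nonempty
  · rcases lt_or_gt_of_ne hne with hh | hh
    · exact hdisj h₁ h₂ hh
    · exact (hdisj h₂ h₁ hh).symm
  · rcases lt_or_gt_of_ne hE.ne with hh | hh
    · exact hadj h₁ h₂ hh hE
    · obtain ⟨u, hu, v, hv, huv⟩ := hadj h₂ h₁ hh hE.symm
      exact ⟨v, hv, u, hu, huv.symm⟩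

end Transfer

/-! ### The connected set obtained from the paths -/

section Paths

variable {V : Type*} {G : SimpleGraph V} {x z : V}

/-- On a walk that ends outside the closed neighbourhood of `x`, the part after the last neighbour
of `x` is a connected set avoiding that closed neighbourhood. -/
theorem SimpleGraph.Walk.exists_last_neighbor {u : V} (p : G.Walk u z) (hzx : z ≠ x)
    (hz : ¬ G.Adj x z) :
    (∀ v ∈ p.support, v ≠ x ∧ ¬ G.Adj x v) ∨
      ∃ a ∈ p.support, G.Adj x a ∧ ∃ K : Set V, z ∈ K ∧ (G.induce K).Connected ∧
        (∀ v ∈ K, v ≠ x ∧ ¬ G.Adj x v) ∧ ∃ b ∈ K, G.Adj a b := by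
  induction p with
  | nil => exact Or.inl (by simpa using ⟨hzx, hz⟩)
  | @cons u v _ huv p ih =>
    rcases ih hzx hz with h | ⟨a, ha, h⟩
    · by_cases hu : G.Adj x u
      · exact Or.inr ⟨u, by simp, hu, {w | w ∈ p.support}, p.end_mem_support,
          p.connected_induce_support, h, v, p.start_mem_support, huv⟩
      · refine Or.inl fun w hw => ?_
        rcases List.mem_cons.1 (p.support_cons huv ▸ hw) with rfl | hw
        · refine ⟨?_, hu⟩
          -- If `u` were `x`, the next vertex `v` would be a neighbour of `x`.
          rintro rfl
          exact (h v p.start_mem_support).2 huv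
        · exact h w hw
    · exact Or.inr ⟨a, by simp [ha], h⟩

/-- Internally disjoint paths from `x` to a vertex outside its closed neighbourhood yield a
connected set avoiding that closed neighbourhood and adjacent to as many neighbours of `x`. -/
theorem SimpleGraph.HasInternallyDisjointPaths.exists_connected {k : ℕ} [NeZero k]
    (h : G.HasInternallyDisjointPaths x z k) (hzx : z ≠ x) (hz : ¬ G.Adj x z) :
    ∃ (K : Set V) (a : Fin k → V), Function.Injective a ∧ (∀ i, G.Adj x (a i)) ∧
      (G.induce K).Connected ∧ (∀ v ∈ K, v ≠ x ∧ ¬ G.Adj x v) ∧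
      ∀ i, ∃ b ∈ K, G.Adj (a i) b := by
  obtain ⟨P, -, hP⟩ := h
  have h1 : ∀ i, ∃ a ∈ (P i).1.support, G.Adj x a ∧ ∃ K : Set V, z ∈ K ∧
      (G.induce K).Connected ∧ (∀ v ∈ K, v ≠ x ∧ ¬ G.Adj x v) ∧ ∃ b ∈ K, G.Adj a b := fun i =>
    ((P i).1.exists_last_neighbor hzx hz).resolve_left fun h =>
      (h x (P i).1.start_mem_support).1 rfl
  choose a ha hxa K hzK hK hKx hab using h1
  refine ⟨⋃₀ Set.range K, a, fun i j hij => ?_, hxa, ?_, ?_, fun i => ?_⟩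
  -- A vertex common to two of the paths is `x` or `z`, and neither is a neighbour of `x`.
  · by_contra hne
    rcases hP i j hne (a i) (ha i) (hij ▸ ha j) with h | h
    · exact (hxa i).ne h.symm
    · exact hz (h ▸ hxa i)
  · refine SimpleGraph.induce_sUnion_connected_of_pairwise_not_disjoint
      (Set.range_nonempty K) ?_ ?_
    · rintro _ _ ⟨i, rfl⟩ ⟨j, rfl⟩
      exact ⟨z, hzK i, hzK j⟩
    · rintro _ ⟨i, rfl⟩
      exact hK i
  · rintro v ⟨_, ⟨i, rfl⟩, hv⟩
    exact hKx i v hv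
  · obtain ⟨b, hb, hab⟩ := hab i
    exact ⟨b, ⟨_, ⟨i, rfl⟩, hb⟩, hab⟩

end Paths

/-! ### The sets represented by the labels -/

/-- The vertex sets represented by the labels: the vertices `f 0, …, f 9`, the set `K` and the
vertex `x`. -/
def labelSet {V : Type*} (f : ℕ → V) (K : Set V) (x : V) (i : ℕ) : Set V :=
  if i < 10 then {f i} else if i = 10 then K else {x}

section LabelSet

variable {V : Type*} {f : ℕ → V} {K : Set V} {x : V}

theorem labelSet_of_lt {i : ℕ} (hi : i < 10) : labelSet f K x i = {f i} := if_pos hi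

theorem labelSet_ten : labelSet f K x 10 = K := rfl

theorem labelSet_eleven : labelSet f K x 11 = {x} := rfl

theorem lt_twelve_cases {i : ℕ} (hi : i < 12) : i < 10 ∨ i = 10 ∨ i = 11 := by omega

variable {G : SimpleGraph V}

theorem connected_labelSet (hK : (G.induce K).Connected) {i : ℕ} (hi : i < 12) :
    (G.induce (labelSet f K x i)).Connected := by
  rcases lt_twelve_cases hi with hi | rfl | rfl
  · rw [labelSet_of_lt hi]
    exact SimpleGraph.Connected.of_subsingleton
  · exact hK
  · rw [labelSet_eleven]
    exact SimpleGraph.Connected.of_subsingleton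

theorem disjoint_labelSet (hf : Set.InjOn f (Set.Iio 10)) (hfx : ∀ i < 10, G.Adj x (f i))
    (hK : ∀ v ∈ K, v ≠ x ∧ ¬ G.Adj x v) {i j : ℕ} (hi : i < 12) (hj : j < 12) (hij : i ≠ j) :
    Disjoint (labelSet f K x i) (labelSet f K x j) := by
  wlog h : i < j generalizing i j
  · exact (this hj hi hij.symm (by omega)).symm
  rcases lt_twelve_cases hi with hi | rfl | rfl
  · rw [labelSet_of_lt hi, Set.disjoint_singleton_left]
    rcases lt_twelve_cases hj with hj | rfl | rfl
    · rw [labelSet_of_lt hj, Set.mem_singleton_iff]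
      exact fun h => hij (hf hi hj h)
    · exact fun h => (hK _ h).2 (hfx i hi)
    · exact fun h => (hfx i hi).ne (Set.mem_singleton_iff.1 h).symm
  · obtain rfl : j = 11 := by omega
    rw [labelSet_ten, labelSet_eleven, Set.disjoint_singleton_right]
    exact fun h => (hK x h).1 rfl
  · omega

theorem exists_adj_of_labelAdj {E : ℕ} {A : List ℕ} (hfx : ∀ i < 10, G.Adj x (f i))
    (hE : ∀ i < 10, ∀ j < 10, i ≠ j → entry E i j = false → G.Adj (f i) (f j))
    (hA : ∀ i ∈ A, ∃ b ∈ K, G.Adj (f i) b) {i j : ℕ} (hi : i < 12) (hj : j < 12)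
    (h : labelAdj E A i j = true) :
    ∃ u ∈ labelSet f K x i, ∃ v ∈ labelSet f K x j, G.Adj u v := by
  have hA' : ∀ i, anyOf A (Nat.beq i) = true → ∃ b ∈ K, G.Adj (f i) b := by
    intro i hi
    rw [anyOf_eq_any, List.any_eq_true] at hi
    obtain ⟨a, ha, hia⟩ := hi
    obtain rfl := Nat.eq_of_beq_eq_true hia
    exact hA i ha
  have hlt : ∀ {i}, i < 10 → Nat.ble i 9 = true := fun hi => Nat.ble_eq_true_of_le (by omega)
  rcases lt_twelve_cases hi with hi | rfl | rfl
  · rw [labelSet_of_lt hi]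
    rw [labelAdj, hlt hi, cond_true] at h
    refine ⟨f i, rfl, ?_⟩
    rcases lt_twelve_cases hj with hj | rfl | rfl
    · rw [labelSet_of_lt hj]
      rw [hlt hj, cond_true, Bool.and_eq_true, Bool.not_eq_true', Bool.not_eq_true'] at h
      exact ⟨f j, rfl, hE i hi j hj (Nat.ne_of_beq_eq_false h.1) h.2⟩
    · exact hA' i h
    · exact ⟨x, rfl, (hfx i hi).symm⟩
  · rcases lt_twelve_cases hj with hj | rfl | rfl
    · rw [labelAdj, hlt hj] at h
      obtain ⟨b, hb, hjb⟩ := hA' j h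
      rw [labelSet_of_lt hj]
      exact ⟨b, hb, f j, rfl, hjb.symm⟩
    · exact absurd h Bool.false_ne_true
    · exact absurd h Bool.false_ne_true
  · rcases lt_twelve_cases hj with hj | rfl | rfl
    · rw [labelSet_of_lt hj]
      exact ⟨x, rfl, f j, rfl, hfx j hj⟩
    · exact absurd h Bool.false_ne_true
    · exact absurd h Bool.false_ne_true

end LabelSet

/-- A surjection from the labels below `10` hits the values of an injective family of length `n`
on exactly `n` labels. -/
theorem exists_sublistsLen {V : Type*} {n : ℕ} {f : ℕ → V} {a : Fin n → V}
    (ha : Function.Injective a) (hf : ∀ t, ∃ i < 10, f i = a t) :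
    ∃ A ∈ (List.range 10).sublistsLen n, ∀ i ∈ A, ∃ t, f i = a t := by
  classical
  choose g hg hfg using hf
  have hinj : Function.Injective g := fun s t hst => ha (by rw [← hfg, ← hfg, hst])
  -- Filtering keeps the increasing order, so the chosen labels form one of the sublists the test
  -- runs through.
  refine ⟨(List.range 10).filter (· ∈ Finset.univ.image g), List.mem_sublistsLen.2
    ⟨List.filter_sublist, ?_⟩, fun i hi => ?_⟩
  · rw [← List.toFinset_card_of_nodup (List.nodup_range.filter _)]
    have h : ((List.range 10).filter (· ∈ Finset.univ.image g)).toFinset =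
        Finset.univ.image g := by
      ext i
      simp only [List.toFinset_filter, Finset.mem_filter, List.mem_toFinset, List.mem_range,
        decide_eq_true_eq, and_iff_right_iff_imp, Finset.mem_image, Finset.mem_univ, true_and]
      rintro ⟨t, rfl⟩
      exact hg t
    rw [h, Finset.card_image_of_injective _ hinj, Finset.card_univ, Fintype.card_fin]
  · have h := (List.mem_filter.1 hi).2
    simp only [decide_eq_true_eq, Finset.mem_image, Finset.mem_univ, true_and] at h
    obtain ⟨t, rfl⟩ := h
    exact ⟨t, hfg t⟩

/-! ### The computation and the conclusion -/

/-- The search succeeds: in every completion one of the listed models is present. -/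
theorem search_hasListedModel : search hasListedModel 11 0 0 1 = true := by
  -- Fuel `11` covers ten rows and the final call at the leaf.
  decide +kernel

theorem mainTheorem6 {V : Type*} (G : SimpleGraph V) (x z : V)
    [Fintype (G.neighborSet x)] [(G.neighborhoodGraph x)ᶜ.LocallyFinite]
    (hdeg : G.degree x = 10)
    (hconn : (G.neighborhoodGraph x)ᶜ.Connected)
    (hcubic : (G.neighborhoodGraph x)ᶜ.IsRegularOfDegree 3)
    (hzx : z ≠ x) (hz : ¬ G.Adj x z)
    (hpaths : G.HasInternallyDisjointPaths x z 6) :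
    G.HasMinor completeEightMinusEdge := by
  have hU : Nat.card (G.neighborSet x) = 10 := by
    rw [Nat.card_eq_fintype_card, SimpleGraph.card_neighborSet_eq_degree, hdeg]
  have h3 : ∀ v, ((G.neighborhoodGraph x)ᶜ.neighborSet v).ncard = 3 := fun v => by
    rw [← hcubic v, ← SimpleGraph.card_neighborSet_eq_degree, ← Nat.card_eq_fintype_card]
    rfl
  obtain ⟨f, E, hf, hfE, hgood⟩ := exists_labelling hU hconn h3 search_hasListedModel
  obtain ⟨K, a, ha, hxa, hK, hKx, haK⟩ := hpaths.exists_connected hzx hz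
  have hfx : ∀ i < 10, G.Adj x (f i : V) := fun i _ => (f i).2
  have hinj : Set.InjOn (fun i => (f i : V)) (Set.Iio 10) := fun i hi j hj hij =>
    hf hi hj (Subtype.ext hij)
  have hE : ∀ i < 10, ∀ j < 10, i ≠ j → entry E i j = false → G.Adj (f i : V) (f j) := by
    intro i hi j hj hij hEij
    by_contra hadj
    have h : (G.neighborhoodGraph x)ᶜ.Adj (f i) (f j) :=
      (SimpleGraph.compl_adj _ _ _).2 ⟨fun h => hij (hf hi hj h), hadj⟩
    rw [← hfE i hi j hj, hEij] at h
    exact Bool.false_ne_true h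
  have hsurj : ∀ t, ∃ i < 10, (f i : V) = a t := by
    intro t
    have h : f '' Set.Iio 10 = Set.univ := by
      rw [Set.eq_univ_iff_ncard, hf.ncard_image, Set.ncard_Iio_nat, hU]
    obtain ⟨i, hi, hia⟩ := h.symm ▸ Set.mem_univ (⟨a t, hxa t⟩ : G.neighborSet x)
    exact ⟨i, hi, congrArg Subtype.val hia⟩
  obtain ⟨A, hA, hAa⟩ := exists_sublistsLen ha hsurj
  have hAK : ∀ i ∈ A, ∃ b ∈ K, G.Adj (f i : V) b := fun i hi => by
    obtain ⟨t, ht⟩ := hAa i hi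
    rw [ht]
    exact haK t
  -- `B` will be `[]` for models inside `N[x]` and `A` for those using `K`.
  have key : ∀ (B : List ℕ) (W : ℕ × List (List ℕ)), (∀ i ∈ B, ∃ b ∈ K, G.Adj (f i : V) b) →
      wellFormed W.2 = true → isMaskedModel E B W = true →
      G.HasMinor completeEightMinusEdge := by
    intro B W hB hW h
    rw [isMaskedModel] at h
    cases hb : Nat.beq (Nat.land E W.1) 0
    · rw [hb] at h
      exact absurd h Bool.false_ne_true
    · rw [hb] at h
      exact hasMinor_of_isModel (S := labelSet (fun i => (f i : V)) K x)
        (fun i hi => connected_labelSet hK hi)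
        (fun i hi j hj hij => disjoint_labelSet hinj hfx hKx hi hj hij)
        (fun i hi j hj hij => exists_adj_of_labelAdj hfx hE hB hi hj hij) hW h
  rw [hasListedModel, Bool.or_eq_true, anyOf_eq_any, allOf_eq_all, List.any_eq_true,
    List.all_eq_true] at hgood
  rcases hgood with ⟨W, hW, h⟩ | h
  · exact key [] W (fun _ h => absurd h List.not_mem_nil)
      (List.all_eq_true.1 wellFormed_nearModels W hW) h
  · have h := h A hA
    rw [anyOf_eq_any, List.any_eq_true] at h
    obtain ⟨W, hW, h⟩ := h
    exact key A W hAK (List.all_eq_true.1 wellFormed_farModels W hW) h
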